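/- Let $H$ be a complete Heyting algebra (a frame) and let $DH$ be the complete Heyting algebra of its down-closed subsets, ordered by inclusion; write $h^\dagger=\{k\mid k\le h\}$. \emph{Sheaves.} For a presheaf $F:H^{op}\to\mathbf{Set}$ and $A\subseteq H$, a matching family for $A$ is a family $(x_k)_{k\in A}$, $x_k\in F(k)$, with $x_k|_{k\wedge l}=x_l|_{k\wedge l}$ for all $k,l\in A$; $F$ is a sheaf if for every $A\subseteq H$ every matching family for $A$ has a unique amalgamation $x\in F(\bigvee A)$, i.e. $x|_k=x_k$ for all $k\in A$. $\mathbf{SHV}(H)$ is the full subcategory of sheaves in $\mathbf{Set}^{H^{op}}$. \emph{Relational-(pre)sheaves.} A pre-transformation $\tau:A\to B$ between sets is a family of relations $\tau_h\subseteq B\times A$ $(h\in H)$. It is order-preserving if every set $\{h\mid \tau_h(b,a)\}$ is down-closed, and infima-preserving if every such set is a principal down-closed set. In the semicategory $PT_{\mathrm{Ord}}(H)$ of sets and order-preserving pre-transformations, $(\sigma\tau)_h(c,a)$ holds iff there are $k,l$ with $h\le k\wedge l$ and $(\sigma_k\circ\tau_l)(c,a)$; in the semicategory $PT_{\inf}(H)$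 of sets and infima-preserving pre-transformations, it holds iff there is a family $(k_i,l_i)_{i\in I}$ with $h\le\bigvee_i(k_i\wedge l_i)$ and $(\sigma_{k_i}\circ\tau_{l_i})(c,a)$ for all $i$. Both are ordered by $\tau\le\sigma$ iff $\tau_h\subseteq\sigma_h$ for all $h$, with involution $(\tau^*)_h=\tau_h^{-1}$. For an involutive order-enriched semicategory $\mathcal O$, $\mathbf{Kar}^*(\mathcal O)$ is the category whose objects are the arrows $e$ with $e^*=e=ee$ and whose arrows $e\to e'$ are the $\varphi$ with $\varphi e=\varphi=e'\varphi$; $\mathbf{Map}^*$ of an involutive order-enriched category keeps all objects and those arrows $f$ with $1\le f^*f$ and $ff^*\le 1$. Put $\mathbf{Rel}^{H^{co}}_{\mathrm{Ord}}=\mathbf{Map}^*(\mathbf{Kar}^*(PT_{\mathrm{Ord}}(H)))$ (relational-presheaves) and $\mathbf{Rel}^{H^{co}}_{\inf}=\mathbf{Map}^*(\mathbf{Kar}^*(PT_{\inf}(H)))$ (relational-sheaves). \emph{Functors.} \begin{itemize} \item $\Gamma:\mathbf{Set}^{H^{op}}\to\mathbf{SHV}(DH)$, $\Gamma(F)(A)$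 the set of matching families for $A$, and $\Lambda:\mathbf{SHV}(DH)\to\mathbf{Set}^{H^{op}}$, $\Lambda(F)(h)=F(h^\dagger)$, with the evident actions on arrows. \item $\Psi:\mathbf{Rel}^{H^{co}}_{\mathrm{Ord}}\to\mathbf{Rel}^{DH^{co}}_{\inf}$ and $\Phi$ in the other direction, the identity on underlying sets, with $\Psi(\tau)_X(b,a)$ iff $\tau_h(b,a)$ for all $h\in X$, and $\Phi(\tau)_h(b,a)$ iff $\tau_{h^\dagger}(b,a)$. \item $\Delta_{\inf}:\mathbf{Set}^{H^{op}}\to\mathbf{Rel}^{H^{co}}_{\inf}$: the underlying set of $\Delta_{\inf}(F)$ is $\coprod_hF(h)$; for $b\in F(l)$, $a\in F(k)$, $\Delta_{\inf}(F)_h(b,a)$ holds iff $h\le\bigvee\{m\le k\wedge l\mid b|_m=a|_m\}$; for $\tau:F\to G$, $b\in G(l)$, $a\in F(k)$, $\Delta_{\inf}(\tau)_h(b,a)$ holds iff $h\le\bigvee\{m\le k\wedge l\mid b|_m=\tau_k(a)|_m\}$. \item $\Theta_{\inf}:\mathbf{Rel}^{H^{co}}_{\inf}\to\mathbf{Set}^{H^{op}}$: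 $\Theta_{\inf}(F)(h)=\mathrm{Hom}(F_h,F)$, where $F_h$ is the relational-sheaf on a one-point set with $(F_h)_k(*,*)$ iff $k\le h$; restriction along $k\le h$ is composition with the morphism $F_k\to F_h$ whose $l$-th relation holds iff $l\le k$, and $\Theta_{\inf}(\tau)$ is composition with $\tau$. It takes values in sheaves. \item $\Delta_{\mathbf{Shv}}:\mathbf{SHV}(H)\to\mathbf{Rel}^{H^{co}}_{\inf}$ is the restriction of $\Delta_{\inf}$ and $\Theta_{\mathbf{Shv}}:\mathbf{Rel}^{H^{co}}_{\inf}\to\mathbf{SHV}(H)$ the corestriction of $\Theta_{\inf}$; these are also used with $DH$ in place of $H$. \end{itemize} Put $\Delta_{\mathbf{Pre}}=\Phi\circ\Delta_{\mathbf{Shv}}\circ\Gamma$, $\Theta_{\mathbf{Pre}}=\Lambda\circ\Theta_{\mathbf{Shv}}\circ\Psi$ (with $\Delta_{\mathbf{Shv}},\Theta_{\mathbf{Shv}}$ for $DH$), $a_{\mathbf{Shv}}=\Theta_{\mathbf{Shv}}\circ\Delta_{\inf}$ and $a_{\mathbf{Rel}}=\Delta_{\inf}\circ\Theta_{\mathbf{Pre}}$.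 \textbf{Theorem.} \begin{enumerate} \item $\Delta_{\mathbf{Pre}}:\mathbf{Set}^{H^{op}}\to\mathbf{Rel}^{H^{co}}_{\mathrm{Ord}}$ is an equivalence of categories with quasi-inverse $\Theta_{\mathbf{Pre}}$. Moreover each factor is an equivalence: $\Gamma:\mathbf{Set}^{H^{op}}\to\mathbf{SHV}(DH)$ with quasi-inverse $\Lambda$, $\Delta_{\mathbf{Shv}}:\mathbf{SHV}(DH)\to\mathbf{Rel}^{DH^{co}}_{\inf}$ with quasi-inverse $\Theta_{\mathbf{Shv}}$, and $\Phi:\mathbf{Rel}^{DH^{co}}_{\inf}\to\mathbf{Rel}^{H^{co}}_{\mathrm{Ord}}$ with quasi-inverse $\Psi$. \item The associated sheaf functor $a_{\mathbf{Shv}}:\mathbf{Set}^{H^{op}}\to\mathbf{SHV}(H)$ is left adjoint to $\Theta_{\inf}\circ\Delta_{\mathbf{Shv}}:\mathbf{SHV}(H)\to\mathbf{Set}^{H^{op}}$, and the latter is naturally isomorphic to the inclusion of sheaves into presheaves. \item The associated relational-sheaf functor $a_{\mathbf{Rel}}:\mathbf{Rel}^{H^{co}}_{\mathrm{Ord}}\to\mathbf{Rel}^{H^{co}}_{\inf}$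 is left adjoint to $\Delta_{\mathbf{Pre}}\circ\Theta_{\inf}:\mathbf{Rel}^{H^{co}}_{\inf}\to\mathbf{Rel}^{H^{co}}_{\mathrm{Ord}}$. \end{enumerate} -/

import Mathlib

open CategoryTheory Opposite

universe w v u

namespace RelSh

/-! ### Involutive order-enriched semicategories and categories -/

/-- An involutive order-enriched semicategory: hom-sets are partial orders, composition is
associative and order-preserving (there need not be identities), and there is an
order-preserving contravariant involution which is the identity on objects.
`comp f g` is "first `f`, then `g`", i.e. `g ∘ f`. -/
class InvOrdSemicategory (C : Type w) where
  Hom : C → C → Type v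
  homOrder : ∀ A B : C, PartialOrder (Hom A B)
  comp : ∀ {A B D : C}, Hom A B → Hom B D → Hom A D
  assoc : ∀ {A B D E : C} (f : Hom A B) (g : Hom B D) (h : Hom D E),
    comp (comp f g) h = comp f (comp g h)
  comp_mono : ∀ {A B D : C} {f f' : Hom A B} {g g' : Hom B D},
    f ≤ f' → g ≤ g' → comp f g ≤ comp f' g'
  star : ∀ {A B : C}, Hom A B → Hom B A
  star_star : ∀ {A B : C} (f : Hom A B), star (star f) = f
  star_comp : ∀ {A B D : C} (f : Hom A B) (g : Hom B D),
    star (comp f g) = comp (star g) (star f)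
  star_mono : ∀ {A B : C} {f g : Hom A B}, f ≤ g → star f ≤ star g

namespace InvOrdSemicategory
attribute [reducible, instance] InvOrdSemicategory.homOrder
end InvOrdSemicategory

/-- An involutive order-enriched category. -/
class InvOrdCategory (O : Type w) [Category.{v} O] where
  homOrder : ∀ A B : O, PartialOrder (A ⟶ B)
  comp_mono : ∀ {A B D : O} {f f' : A ⟶ B} {g g' : B ⟶ D},
    f ≤ f' → g ≤ g' → f ≫ g ≤ f' ≫ g'
  star : ∀ {A B : O}, (A ⟶ B) → (B ⟶ A)
  star_star : ∀ {A B : O} (f : A ⟶ B), star (star f) = f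
  star_id : ∀ A : O, star (𝟙 A) = 𝟙 A
  star_comp : ∀ {A B D : O} (f : A ⟶ B) (g : B ⟶ D), star (f ≫ g) = star g ≫ star f
  star_mono : ∀ {A B : O} {f g : A ⟶ B}, f ≤ g → star f ≤ star g

namespace InvOrdCategory
attribute [reducible, instance] InvOrdCategory.homOrder
end InvOrdCategory

/-! ### The symmetric Karoubian envelope `Kar*` -/

section Kar

open InvOrdSemicategory

/-- Objects of `Kar*(C)`: symmetric idempotent arrows of `C`. -/
structure KarStar (C : Type w) [InvOrdSemicategory.{w, v} C] where
  carrier : C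
  e : InvOrdSemicategory.Hom carrier carrier
  symm : star e = e
  idem : comp e e = e

variable {C : Type w} [InvOrdSemicategory.{w, v} C]

/-- Arrows `f ⟶ g` of `Kar*(C)`: arrows `φ` of `C` with `φ ∘ f = φ = g ∘ φ`. -/
@[ext]
structure KarStar.Hom (f g : KarStar C) where
  φ : InvOrdSemicategory.Hom f.carrier g.carrier
  left : comp f.e φ = φ
  right : comp φ g.e = φ

instance : Category.{v} (KarStar C) where
  Hom := KarStar.Hom
  id f := ⟨f.e, f.idem, f.idem⟩
  comp φ ψ := ⟨comp φ.φ ψ.φ, by rw [← assoc, φ.left], by rw [assoc, ψ.right]⟩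
  id_comp φ := KarStar.Hom.ext φ.left
  comp_id φ := KarStar.Hom.ext φ.right
  assoc φ ψ χ := KarStar.Hom.ext (assoc φ.φ ψ.φ χ.φ)

instance : InvOrdCategory (KarStar C) where
  homOrder f g := PartialOrder.lift (fun φ : KarStar.Hom f g => φ.φ)
    (fun _ _ h => KarStar.Hom.ext h)
  comp_mono h h' := comp_mono (C := C) h h'
  star {f g} φ := ⟨star φ.φ, by conv_lhs => rw [← g.symm, ← star_comp, φ.right],
    by conv_lhs => rw [← f.symm, ← star_comp, φ.left]⟩
  star_star φ := KarStar.Hom.ext (star_star φ.φ)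
  star_id f := KarStar.Hom.ext f.symm
  star_comp φ ψ := KarStar.Hom.ext (star_comp φ.φ ψ.φ)
  star_mono h := star_mono (C := C) h

end Kar

/-! ### The category `Map*` of symmetric maps -/

section Map

open InvOrdCategory

/-- Objects of `Map*(O)`: all objects of `O`. -/
structure MapStar (O : Type w) where
  of : O

variable {O : Type w} [Category.{v} O] [InvOrdCategory O]

/-- Arrows of `Map*(O)`: symmetric maps, i.e. `1 ≤ f* ∘ f` and `f ∘ f* ≤ 1`. -/
@[ext]
structure MapStar.Hom (A B : MapStar O) where
  f : A.of ⟶ B.of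
  total : 𝟙 A.of ≤ f ≫ star f
  single : star f ≫ f ≤ 𝟙 B.of

instance : Category.{v} (MapStar O) where
  Hom := MapStar.Hom
  id A := ⟨𝟙 A.of, by rw [star_id, Category.id_comp], by rw [star_id, Category.id_comp]⟩
  comp {A B D} f g := ⟨f.f ≫ g.f,
    by
      have h := comp_mono (le_refl f.f) (comp_mono g.total (le_refl (star f.f)))
      rw [Category.id_comp] at h
      rw [star_comp]
      simpa only [Category.assoc] using f.total.trans h,
    by
      have h := comp_mono (le_refl (star g.f)) (comp_mono f.single (le_refl g.f))
      rw [Category.id_comp] at h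
      rw [star_comp]
      simpa only [Category.assoc] using h.trans g.single⟩
  id_comp f := MapStar.Hom.ext (Category.id_comp f.f)
  comp_id f := MapStar.Hom.ext (Category.comp_id f.f)
  assoc f g h := MapStar.Hom.ext (Category.assoc f.f g.f h.f)

end Map

/-! ### Semifunctors of involutive order-enriched semicategories -/

section Semifunctor

open InvOrdSemicategory

/-- A semifunctor which preserves the order and the involution. -/
structure InvOrdSemifunctor (C : Type w) [InvOrdSemicategory.{w, v} C]
    (D : Type w) [InvOrdSemicategory.{w, v} D] where
  obj : C → D
  map : ∀ {A B : C}, InvOrdSemicategory.Hom A B → InvOrdSemicategory.Hom (obj A) (obj B)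
  map_comp : ∀ {A B E : C} (f : InvOrdSemicategory.Hom A B) (g : InvOrdSemicategory.Hom B E),
    map (comp f g) = comp (map f) (map g)
  map_star : ∀ {A B : C} (f : InvOrdSemicategory.Hom A B), map (star f) = star (map f)
  map_mono : ∀ {A B : C} {f g : InvOrdSemicategory.Hom A B}, f ≤ g → map f ≤ map g

variable {C : Type w} [InvOrdSemicategory.{w, v} C] {D : Type w} [InvOrdSemicategory.{w, v} D]

/-- The functor `Map*(Kar*(C)) ⥤ Map*(Kar*(D))` induced by a semifunctor. -/
def InvOrdSemifunctor.mapKar (T : InvOrdSemifunctor C D) :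
    MapStar (KarStar C) ⥤ MapStar (KarStar D) where
  obj X := ⟨⟨T.obj X.of.carrier, T.map X.of.e, by rw [← T.map_star, X.of.symm],
    by rw [← T.map_comp, X.of.idem]⟩⟩
  map {X Y} f := ⟨⟨T.map f.f.φ, (T.map_comp _ _).symm.trans (congrArg T.map f.f.left),
    (T.map_comp _ _).symm.trans (congrArg T.map f.f.right)⟩,
    by
      have h : T.map X.of.e ≤ T.map (comp f.f.φ (star f.f.φ)) := T.map_mono f.total
      rw [T.map_comp, T.map_star] at h
      exact h,
    by
      have h : T.map (comp (star f.f.φ) f.f.φ) ≤ T.map Y.of.e := T.map_mono f.single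
      rw [T.map_comp, T.map_star] at h
      exact h⟩
  map_id _ := rfl
  map_comp f g := MapStar.Hom.ext (KarStar.Hom.ext (T.map_comp f.f.φ g.f.φ))

end Semifunctor

/-! ### Pre-transformations -/

section PreTransformation

/-- An order-preserving pre-transformation `A → B`: an `H`-indexed family of relations
(`rel h b a` is `τ_h(b, a) = 1`) such that every set `{h | τ_h(b, a) = 1}` is down-closed. -/
@[ext]
structure OrdPT (H : Type u) [Order.Frame H] (A B : Type u) where
  rel : H → B → A → Prop
  lower : ∀ a b, IsLowerSet {h | rel h b a}

/-- An infima-preserving pre-transformation `A → B`: an `H`-indexed family of relations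
such that every set `{h | τ_h(b, a) = 1}` is a principal down-closed set. -/
@[ext]
structure InfPT (H : Type u) [Order.Frame H] (A B : Type u) where
  rel : H → B → A → Prop
  principal : ∀ a b, ∃ m : H, {h | rel h b a} = Set.Iic m

/-- The objects of `PT_Ord(H)`: sets. -/
structure PTOrd (H : Type u) where
  set : Type u

/-- The objects of `PT_inf(H)`: sets. -/
structure PTInf (H : Type u) where
  set : Type u

variable {H : Type u} [Order.Frame H]

/-- The composite `σ ∘ τ` of order-preserving pre-transformations. -/
def OrdPT.comp {A B D : Type u} (τ : OrdPT H A B) (σ : OrdPT H B D) : OrdPT H A D where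
  rel h c a := ∃ k l : H, h ≤ k ⊓ l ∧ ∃ b, σ.rel k c b ∧ τ.rel l b a
  lower := by
    rintro a c h h' hh ⟨k, l, hkl, hb⟩
    exact ⟨k, l, hh.trans hkl, hb⟩

theorem OrdPT.comp_rel {A B D : Type u} (τ : OrdPT H A B) (σ : OrdPT H B D) (h : H) (c : D)
    (a : A) : (τ.comp σ).rel h c a ↔ ∃ b, σ.rel h c b ∧ τ.rel h b a := by
  constructor
  · rintro ⟨k, l, hkl, b, h1, h2⟩
    exact ⟨b, σ.lower b c (hkl.trans inf_le_left) h1, τ.lower a b (hkl.trans inf_le_right) h2⟩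
  · rintro ⟨b, h1, h2⟩
    exact ⟨h, h, by simp, b, h1, h2⟩

theorem OrdPT.ext_iff' {A B : Type u} {τ σ : OrdPT H A B}
    (h : ∀ k b a, τ.rel k b a ↔ σ.rel k b a) : τ = σ :=
  OrdPT.ext (funext fun k => funext fun b => funext fun a => propext (h k b a))

/-- `PT_Ord(H)`, with `τ ≤ σ` when `τ_h ⊆ σ_h` for all `h`, and `(τ*)_h` the inverse of `τ_h`. -/
instance : InvOrdSemicategory.{u + 1, u} (PTOrd H) where
  Hom A B := OrdPT H A.set B.set
  homOrder A B := PartialOrder.lift OrdPT.rel (fun _ _ h => OrdPT.ext h)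
  comp := OrdPT.comp
  assoc f g h := OrdPT.ext_iff' fun k b a => by
    simp only [OrdPT.comp_rel]
    constructor
    · rintro ⟨x, h1, y, h2, h3⟩
      exact ⟨y, ⟨x, h1, h2⟩, h3⟩
    · rintro ⟨y, ⟨x, h1, h2⟩, h3⟩
      exact ⟨x, h1, y, h2, h3⟩
  comp_mono h h' := by
    rintro m c a ⟨k, l, hkl, b, h1, h2⟩
    exact ⟨k, l, hkl, b, h' _ _ _ h1, h _ _ _ h2⟩
  star τ := ⟨fun h a b => τ.rel h b a, fun b a => τ.lower a b⟩
  star_star _ := rfl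
  star_comp f g := OrdPT.ext_iff' fun k b a => by
    refine (OrdPT.comp_rel f g k a b).trans (Iff.trans ?_ (OrdPT.comp_rel _ _ k b a).symm)
    exact ⟨fun ⟨x, h1, h2⟩ => ⟨x, h2, h1⟩, fun ⟨x, h1, h2⟩ => ⟨x, h2, h1⟩⟩
  star_mono h := fun m a b => h m b a

/-- The generator `⋁ {h | τ_h(b, a) = 1}` of the principal down-closed set at `(b, a)`. -/
def InfPT.val {A B : Type u} (τ : InfPT H A B) (b : B) (a : A) : H := sSup {h | τ.rel h b a}

theorem InfPT.rel_iff {A B : Type u} (τ : InfPT H A B) (h : H) (b : B) (a : A) :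
    τ.rel h b a ↔ h ≤ τ.val b a := by
  obtain ⟨m, hm⟩ := τ.principal a b
  have h1 : τ.rel h b a ↔ h ∈ {h | τ.rel h b a} := Iff.rfl
  rw [h1, InfPT.val, hm, csSup_Iic, Set.mem_Iic]

theorem InfPT.ext_val {A B : Type u} {τ σ : InfPT H A B} (h : ∀ b a, τ.val b a = σ.val b a) :
    τ = σ :=
  InfPT.ext (funext fun k => funext fun b => funext fun a => propext
    (by rw [τ.rel_iff, σ.rel_iff, h]))

/-- The pre-transformation of a matrix `M`: `τ_h(b, a) = 1` iff `h ≤ M(b, a)`. -/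
def InfPT.ofMatrix {A B : Type u} (M : B → A → H) : InfPT H A B where
  rel h b a := h ≤ M b a
  principal a b := ⟨M b a, rfl⟩

@[simp]
theorem InfPT.val_ofMatrix {A B : Type u} (M : B → A → H) (b : B) (a : A) :
    (InfPT.ofMatrix M).val b a = M b a := csSup_Iic

theorem InfPT.comp_aux {A B D : Type u} (τ : InfPT H A B) (σ : InfPT H B D) (h : H) (c : D)
    (a : A) : (∃ (I : Type u) (k l : I → H), h ≤ ⨆ i, k i ⊓ l i ∧
      ∀ i, ∃ b, σ.rel (k i) c b ∧ τ.rel (l i) b a) ↔ h ≤ ⨆ b, σ.val c b ⊓ τ.val b a := by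
  constructor
  · rintro ⟨I, k, l, hkl, hb⟩
    refine hkl.trans (iSup_le fun i => ?_)
    obtain ⟨b, h1, h2⟩ := hb i
    exact (inf_le_inf ((σ.rel_iff _ _ _).1 h1) ((τ.rel_iff _ _ _).1 h2)).trans
      (le_iSup (fun b => σ.val c b ⊓ τ.val b a) b)
  · intro hh
    exact ⟨B, fun b => σ.val c b, fun b => τ.val b a, hh,
      fun b => ⟨b, (σ.rel_iff _ _ _).2 le_rfl, (τ.rel_iff _ _ _).2 le_rfl⟩⟩

/-- The composite `σ ∘ τ` of infima-preserving pre-transformations. -/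
def InfPT.comp {A B D : Type u} (τ : InfPT H A B) (σ : InfPT H B D) : InfPT H A D where
  rel h c a := ∃ (I : Type u) (k l : I → H), h ≤ ⨆ i, k i ⊓ l i ∧
    ∀ i, ∃ b, σ.rel (k i) c b ∧ τ.rel (l i) b a
  principal a c := ⟨⨆ b, σ.val c b ⊓ τ.val b a, Set.ext fun h => InfPT.comp_aux τ σ h c a⟩

theorem InfPT.val_comp {A B D : Type u} (τ : InfPT H A B) (σ : InfPT H B D) (c : D) (a : A) :
    (τ.comp σ).val c a = ⨆ b, σ.val c b ⊓ τ.val b a :=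
  eq_of_forall_le_iff fun h => by
    rw [← InfPT.rel_iff]
    exact InfPT.comp_aux τ σ h c a

/-- The inverse of every relation in the family. -/
def InfPT.inv {A B : Type u} (τ : InfPT H A B) : InfPT H B A where
  rel h a b := τ.rel h b a
  principal b a := τ.principal a b

theorem InfPT.val_inv {A B : Type u} (τ : InfPT H A B) (a : A) (b : B) :
    τ.inv.val a b = τ.val b a := rfl

instance {A B : Type u} : PartialOrder (InfPT H A B) :=
  PartialOrder.lift InfPT.rel (fun _ _ h => InfPT.ext h)

theorem InfPT.le_iff {A B : Type u} {τ σ : InfPT H A B} :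
    τ ≤ σ ↔ ∀ b a, τ.val b a ≤ σ.val b a := by
  constructor
  · intro h b a
    exact (σ.rel_iff _ _ _).1 (h _ b a ((τ.rel_iff _ _ _).2 le_rfl))
  · intro h k b a hk
    exact (σ.rel_iff _ _ _).2 (((τ.rel_iff _ _ _).1 hk).trans (h b a))

/-- `PT_inf(H)`, with `τ ≤ σ` when `τ_h ⊆ σ_h` for all `h`, and `(τ*)_h` the inverse of `τ_h`. -/
instance : InvOrdSemicategory.{u + 1, u} (PTInf H) where
  Hom A B := InfPT H A.set B.set
  homOrder A B := inferInstance
  comp := InfPT.comp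
  assoc f g h := InfPT.ext_val fun d a => by
    simp only [InfPT.val_comp, inf_iSup_eq, iSup_inf_eq, inf_assoc]
    exact iSup_comm
  comp_mono h h' := InfPT.le_iff.2 fun c a => by
    simp only [InfPT.val_comp]
    exact iSup_mono fun b => inf_le_inf (InfPT.le_iff.1 h' c b) (InfPT.le_iff.1 h b a)
  star := InfPT.inv
  star_star _ := rfl
  star_comp f g := InfPT.ext_val fun a c => by
    simp only [InfPT.val_comp, InfPT.val_inv]
    exact iSup_congr fun b => inf_comm _ _
  star_mono h := fun m a b => h m b a

end PreTransformation

/-! ### Relational-presheaves and relational-sheaves -/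

/-- The category `Rel^{H^co}_Ord = Map*(Kar*(PT_Ord(H)))` of relational-presheaves. -/
abbrev RelPresheaf (H : Type u) [Order.Frame H] := MapStar (KarStar (PTOrd H))

/-- The category `Rel^{H^co}_inf = Map*(Kar*(PT_inf(H)))` of relational-sheaves. -/
abbrev RelSheaf (H : Type u) [Order.Frame H] := MapStar (KarStar (PTInf H))

section Comparison

variable (H : Type u) [Order.Frame H]

/-- `Ψ : PT_Ord(H) → PT_inf(DH)`: `Ψ(τ)_X(b, a) = 1` iff `τ_h(b, a) = 1` for every `h ∈ X`. -/
def psiSemi : InvOrdSemifunctor (PTOrd H) (PTInf (LowerSet H)) where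
  obj A := ⟨A.set⟩
  map {A B} τ :=
    { rel := fun X b a => ∀ h ∈ X, OrdPT.rel τ h b a
      principal := fun a b => ⟨⟨{h | OrdPT.rel τ h b a}, OrdPT.lower τ a b⟩, rfl⟩ }
  map_comp {A B E} f g := InfPT.ext (funext fun X => funext fun c => funext fun a => propext (by
    constructor
    · intro hX
      have hX' : ∀ h : X, ∃ k l : H, h.1 ≤ k ⊓ l ∧ ∃ b, OrdPT.rel g k c b ∧ OrdPT.rel f l b a :=
        fun h => hX h.1 h.2
      choose k l hkl b h1 h2 using hX'
      refine ⟨X, fun h => LowerSet.Iic (k h), fun h => LowerSet.Iic (l h), ?_, fun h =>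
        ⟨b h, fun m hm => OrdPT.lower g (b h) c hm (h1 h),
          fun m hm => OrdPT.lower f a (b h) hm (h2 h)⟩⟩
      intro h hh
      rw [LowerSet.coe_iSup, Set.mem_iUnion]
      exact ⟨⟨h, hh⟩, (hkl ⟨h, hh⟩).trans inf_le_left, (hkl ⟨h, hh⟩).trans inf_le_right⟩
    · rintro ⟨I, K, L, hX, hb⟩ h hh
      have := hX hh
      rw [LowerSet.coe_iSup, Set.mem_iUnion] at this
      obtain ⟨i, hK, hL⟩ := this
      obtain ⟨b, h1, h2⟩ := hb i
      exact ⟨h, h, by simp, b, h1 h hK, h2 h hL⟩))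
  map_star _ := rfl
  map_mono h := fun X b a hX k hk => h k b a (hX k hk)

/-- `Φ : PT_inf(DH) → PT_Ord(H)`: `Φ(τ)_h(b, a) = 1` iff `τ_{h†}(b, a) = 1`. -/
def phiSemi : InvOrdSemifunctor (PTInf (LowerSet H)) (PTOrd H) where
  obj A := ⟨A.set⟩
  map {A B} τ :=
    { rel := fun h b a => InfPT.rel τ (LowerSet.Iic h) b a
      lower := fun a b h k hk hh => by
        have h1 : LowerSet.Iic h ≤ InfPT.val τ b a := (InfPT.rel_iff τ _ b a).1 hh
        exact (InfPT.rel_iff τ _ b a).2 ((LowerSet.Iic_le.2 hk).trans h1) }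
  map_comp {A B E} f g := OrdPT.ext_iff' fun h c a => by
    refine Iff.trans ?_ (OrdPT.comp_rel _ _ h c a).symm
    show InfPT.rel (InfPT.comp f g) (LowerSet.Iic h) c a ↔
      ∃ b, InfPT.rel g (LowerSet.Iic h) c b ∧ InfPT.rel f (LowerSet.Iic h) b a
    simp only [InfPT.rel_iff, InfPT.val_comp, LowerSet.Iic_le, LowerSet.mem_iSup_iff,
      LowerSet.mem_inf_iff]
  map_star _ := rfl
  map_mono h := fun k b a hk => h _ b a hk

/-- `Ψ : Rel^{H^co}_Ord ⥤ Rel^{DH^co}_inf`. -/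
def Psi : RelPresheaf H ⥤ RelSheaf (LowerSet H) := (psiSemi H).mapKar

/-- `Φ : Rel^{DH^co}_inf ⥤ Rel^{H^co}_Ord`. -/
def Phi : RelSheaf (LowerSet H) ⥤ RelPresheaf H := (phiSemi H).mapKar

end Comparison

/-! ### Presheaves and sheaves on a complete Heyting algebra -/

section Sheaves

variable {H : Type u} [Order.Frame H]

/-- The restriction `x|_k` of `x ∈ F(h)` for `k ≤ h`. -/
def res (F : Hᵒᵖ ⥤ Type u) {h k : H} (hk : k ≤ h) (x : F.obj (op h)) : F.obj (op k) :=
  F.map (homOfLE hk).op x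

theorem res_self (F : Hᵒᵖ ⥤ Type u) {h : H} (x : F.obj (op h)) : res F le_rfl x = x := by
  simp [res]

theorem res_res (F : Hᵒᵖ ⥤ Type u) {h k l : H} (hk : k ≤ h) (hl : l ≤ k) (x : F.obj (op h)) :
    res F hl (res F hk x) = res F (hl.trans hk) x := by
  have : (homOfLE (hl.trans hk)).op = (homOfLE hk).op ≫ (homOfLE hl).op := Subsingleton.elim _ _
  simp [res, this]

theorem app_res {F G : Hᵒᵖ ⥤ Type u} (τ : F ⟶ G) {h k : H} (hk : k ≤ h) (x : F.obj (op h)) :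
    τ.app (op k) (res F hk x) = res G hk (τ.app (op h) x) := by
  simp [res]

/-- Matching families `⟨x_k⟩_{k ∈ A}`: `x_k ∈ F(k)`, and `x_k`, `x_l` agree on `k ⊓ l`. -/
def MatchingFamily (F : Hᵒᵖ ⥤ Type u) (A : Set H) : Type u :=
  {x : ∀ k : A, F.obj (op k.1) //
    ∀ k l : A, res F inf_le_left (x k) = res F (k := k.1 ⊓ l.1) inf_le_right (x l)}

/-- `x ∈ F(⋁ A)` is an amalgamation of a matching family on `A` if `x|_k = x_k` for all `k`. -/
def IsAmalgamation (F : Hᵒᵖ ⥤ Type u) {A : Set H} (X : MatchingFamily F A)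
    (x : F.obj (op (sSup A))) : Prop :=
  ∀ k : A, res F (le_sSup k.2) x = X.1 k

/-- A presheaf is a sheaf if every matching family has a unique amalgamation. -/
def IsShf (F : Hᵒᵖ ⥤ Type u) : Prop :=
  ∀ (A : Set H) (X : MatchingFamily F A), ∃! x, IsAmalgamation F X x

variable (H) in
/-- The full subcategory of sheaves. -/
abbrev SHV := ObjectProperty.FullSubcategory (fun F : Hᵒᵖ ⥤ Type u => IsShf F)

variable (H) in
/-- The inclusion of sheaves into presheaves. -/
abbrev shvIncl : SHV H ⥤ (Hᵒᵖ ⥤ Type u) := ObjectProperty.ι _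

theorem MatchingFamily.res_eq {F : Hᵒᵖ ⥤ Type u} {A : Set H} (X : MatchingFamily F A)
    {k l : H} (hk : k ∈ A) (hl : l ∈ A) (h : k ≤ l) : res F h (X.1 ⟨l, hl⟩) = X.1 ⟨k, hk⟩ := by
  have h1 := X.2 ⟨k, hk⟩ ⟨l, hl⟩
  have h2 := congrArg (res F (le_inf le_rfl h)) h1
  simp only [res_res, res_self] at h2
  exact h2.symm

/-- Restriction of a matching family to a subset. -/
def MatchingFamily.restrict {F : Hᵒᵖ ⥤ Type u} {A B : Set H} (h : B ⊆ A)
    (X : MatchingFamily F A) : MatchingFamily F B :=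
  ⟨fun k => X.1 ⟨k.1, h k.2⟩, fun k l => X.2 ⟨k.1, h k.2⟩ ⟨l.1, h l.2⟩⟩

/-- The presheaf `Γ(F)` on the down-closed subsets of `H`: `Γ(F)(A)` is the set of
matching families for `A`. -/
def gammaObj (F : Hᵒᵖ ⥤ Type u) : (LowerSet H)ᵒᵖ ⥤ Type u where
  obj A := MatchingFamily F (A.unop : Set H)
  map f := ↾fun X => X.restrict (leOfHom f.unop)

theorem gammaObj_res (F : Hᵒᵖ ⥤ Type u) {A B : LowerSet H} (h : B ≤ A)
    (X : MatchingFamily F (A : Set H)) :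
    res (gammaObj F) h X = X.restrict h := rfl

theorem gammaObj_isShf (F : Hᵒᵖ ⥤ Type u) : IsShf (gammaObj F) := by
  intro 𝒜 X
  have key : ∀ (B : LowerSet H) (hB : B ∈ 𝒜) (C : LowerSet H) (hC : C ∈ 𝒜) (h : H)
      (h1 : h ∈ B) (h2 : h ∈ C), (X.1 ⟨B, hB⟩).1 ⟨h, h1⟩ = (X.1 ⟨C, hC⟩).1 ⟨h, h2⟩ := by
    intro B hB C hC h h1 h2
    exact congrFun (congrArg Subtype.val (X.2 ⟨B, hB⟩ ⟨C, hC⟩)) ⟨h, h1, h2⟩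
  have mem : ∀ h : ((sSup 𝒜 : LowerSet H) : Set H), ∃ B ∈ 𝒜, h.1 ∈ B := fun h =>
    LowerSet.mem_sSup_iff.1 h.2
  choose B hB hm using mem
  refine ⟨⟨fun h => (X.1 ⟨B h, hB h⟩).1 ⟨h.1, hm h⟩, fun k l => ?_⟩, fun C => ?_, ?_⟩
  · rw [MatchingFamily.res_eq (X.1 ⟨B k, hB k⟩) ((B k).lower inf_le_left (hm k)) (hm k),
      MatchingFamily.res_eq (X.1 ⟨B l, hB l⟩) ((B l).lower inf_le_right (hm l)) (hm l)]
    exact key _ _ _ _ _ _ _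
  · apply Subtype.ext
    funext h
    exact key _ _ _ _ _ _ _
  · intro Y hY
    apply Subtype.ext
    funext h
    exact congrFun (congrArg Subtype.val (hY ⟨B h, hB h⟩)) ⟨h.1, hm h⟩

variable (H) in
/-- The functor `Γ : Set^{H^op} ⥤ SHV(DH)`. -/
def Gamma : (Hᵒᵖ ⥤ Type u) ⥤ SHV (LowerSet H) where
  obj F := ⟨gammaObj F, gammaObj_isShf F⟩
  map {F G} τ := ObjectProperty.homMk
    { app := fun A => ↾fun X => (⟨fun k => τ.app (op k.1) (X.1 k), fun k l => by
        rw [← app_res, ← app_res, X.2 k l]⟩ : MatchingFamily G (A.unop : Set H)) }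

variable (H) in
/-- The functor `h ↦ h†` sending `h` to its principal down-closed set. -/
def principalFunctor : H ⥤ LowerSet H where
  obj h := LowerSet.Iic h
  map f := homOfLE (LowerSet.Iic_le.2 (leOfHom f))

variable (H) in
/-- The functor `Λ : SHV(DH) ⥤ Set^{H^op}`, `Λ(F)(h) = F(h†)`. -/
def Lambda : SHV (LowerSet H) ⥤ (Hᵒᵖ ⥤ Type u) :=
  shvIncl (LowerSet H) ⋙ (Functor.whiskeringLeft _ _ _).obj (principalFunctor H).op

end Sheaves

/-! ### The functor `Δ_inf` -/

section Delta

variable {H : Type u} [Order.Frame H]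

/-- The disjoint union `∐_h F(h)`. -/
abbrev Elts (F : Hᵒᵖ ⥤ Type u) : Type u := Σ h : H, F.obj (op h)

/-- For `b ∈ F(l)` and `a ∈ F(k)`, the supremum of the `m ≤ k ⊓ l` with `b|_m = a|_m`. -/
def agree (F : Hᵒᵖ ⥤ Type u) (b a : Elts F) : H :=
  sSup {m | ∃ (hb : m ≤ b.1) (ha : m ≤ a.1), res F hb b.2 = res F ha a.2}

/-- The action of a transformation of presheaves on elements. -/
def eltsMap {F G : Hᵒᵖ ⥤ Type u} (τ : F ⟶ G) (a : Elts F) : Elts G := ⟨a.1, τ.app (op a.1) a.2⟩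

theorem agree_symm (F : Hᵒᵖ ⥤ Type u) (b a : Elts F) : agree F b a = agree F a b := by
  unfold agree
  congr 1
  ext m
  exact ⟨fun ⟨h1, h2, h⟩ => ⟨h2, h1, h.symm⟩, fun ⟨h1, h2, h⟩ => ⟨h2, h1, h.symm⟩⟩

theorem agree_self (F : Hᵒᵖ ⥤ Type u) (a : Elts F) : agree F a a = a.1 :=
  le_antisymm (sSup_le fun _ ⟨h, _, _⟩ => h) (le_sSup ⟨le_rfl, le_rfl, rfl⟩)

theorem agree_le_right (F : Hᵒᵖ ⥤ Type u) (b a : Elts F) : agree F b a ≤ a.1 :=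
  sSup_le fun _ ⟨_, h, _⟩ => h

theorem agree_trans (F : Hᵒᵖ ⥤ Type u) (c b a : Elts F) :
    agree F c b ⊓ agree F b a ≤ agree F c a := by
  unfold agree
  rw [sSup_inf_sSup]
  refine iSup₂_le fun p hp => ?_
  obtain ⟨⟨h1, h2, h⟩, ⟨h1', h2', h'⟩⟩ := hp
  refine le_sSup ⟨inf_le_left.trans h1, inf_le_right.trans h2', ?_⟩
  rw [← res_res F h1 inf_le_left, h, ← res_res F h2' inf_le_right, ← h', res_res, res_res]

theorem agree_map {F G : Hᵒᵖ ⥤ Type u} (τ : F ⟶ G) (b a : Elts F) :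
    agree F b a ≤ agree G (eltsMap τ b) (eltsMap τ a) := by
  refine sSup_le_sSup fun m ⟨h1, h2, h⟩ => ⟨h1, h2, ?_⟩
  simp only [eltsMap]
  rw [← app_res, ← app_res, h]

/-- The family `Δ_inf(τ)`: `Δ_inf(τ)_h(b, a) = 1` iff `h` is below the supremum of the `m` for
which `b|_m = τ(a)|_m`. -/
def deltaPT {F G : Hᵒᵖ ⥤ Type u} (τ : F ⟶ G) : InfPT H (Elts F) (Elts G) :=
  InfPT.ofMatrix fun b a => agree G b (eltsMap τ a)

theorem deltaPT_comp {F G K : Hᵒᵖ ⥤ Type u} (τ : F ⟶ G) (σ : G ⟶ K) :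
    (deltaPT τ).comp (deltaPT σ) = deltaPT (τ ≫ σ) := by
  apply InfPT.ext_val
  intro c a
  simp only [InfPT.val_comp, deltaPT, InfPT.val_ofMatrix]
  have e : eltsMap (τ ≫ σ) a = eltsMap σ (eltsMap τ a) := rfl
  rw [e]
  apply le_antisymm
  · exact iSup_le fun b => (inf_le_inf le_rfl (agree_map σ b _)).trans (agree_trans K _ _ _)
  · refine le_trans (le_inf le_rfl ?_)
      (le_iSup (fun b => agree K c (eltsMap σ b) ⊓ agree G b (eltsMap τ a)) (eltsMap τ a))
    rw [agree_self]
    exact agree_le_right K _ _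

theorem eltsMap_id {F : Hᵒᵖ ⥤ Type u} (a : Elts F) : eltsMap (𝟙 F) a = a := by
  simp [eltsMap]

/-- The relational-sheaf `Δ_inf(F)`: its set is `∐_h F(h)`, and `Δ_inf(F)(h)(b, a) = 1` iff `h` is
below the supremum of the `m` for which `b|_m = a|_m`. -/
def deltaObj (F : Hᵒᵖ ⥤ Type u) : RelSheaf H where
  of :=
    { carrier := ⟨Elts F⟩
      e := (InfPT.ofMatrix fun b a => agree F b a : InfPT H (Elts F) (Elts F))
      symm := InfPT.ext_val fun b a => by
        show InfPT.val (InfPT.inv _) b a = _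
        rw [InfPT.val_inv, InfPT.val_ofMatrix, InfPT.val_ofMatrix, agree_symm]
      idem := by
        have h := deltaPT_comp (𝟙 F) (𝟙 F)
        rw [Category.comp_id] at h
        simp only [deltaPT, eltsMap_id] at h
        exact h }

theorem deltaObj_e (F : Hᵒᵖ ⥤ Type u) : (deltaObj F).of.e = deltaPT (𝟙 F) := by
  simp only [deltaObj, deltaPT, eltsMap_id]

/-- The morphism `Δ_inf(τ)` of relational-sheaves. -/
def deltaMap {F G : Hᵒᵖ ⥤ Type u} (τ : F ⟶ G) : deltaObj F ⟶ deltaObj G where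
  f :=
    { φ := deltaPT τ
      left := by
        rw [deltaObj_e]
        exact (deltaPT_comp _ _).trans (by rw [Category.id_comp])
      right := by
        rw [deltaObj_e]
        exact (deltaPT_comp _ _).trans (by rw [Category.comp_id]) }
  total := by
    show (InfPT.ofMatrix fun b a => agree F b a) ≤ (deltaPT τ).comp (deltaPT τ).inv
    refine InfPT.le_iff.2 fun c a => ?_
    simp only [InfPT.val_comp, InfPT.val_inv, deltaPT, InfPT.val_ofMatrix]
    refine le_trans (le_inf ?_ ?_)
      (le_iSup (fun b => agree G b (eltsMap τ c) ⊓ agree G b (eltsMap τ a)) (eltsMap τ a))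
    · rw [agree_symm F c a]
      exact agree_map τ a c
    · rw [agree_self]
      exact agree_le_right F c a
  single := by
    show (deltaPT τ).inv.comp (deltaPT τ) ≤ (InfPT.ofMatrix fun b a => agree G b a)
    refine InfPT.le_iff.2 fun c b => ?_
    simp only [InfPT.val_comp, InfPT.val_inv, deltaPT, InfPT.val_ofMatrix]
    refine iSup_le fun a => ?_
    rw [agree_symm G b]
    exact agree_trans G _ _ _

variable (H) in
/-- The functor `Δ_inf : Set^{H^op} ⥤ Rel^{H^co}_inf`. -/
def DeltaInf : (Hᵒᵖ ⥤ Type u) ⥤ RelSheaf H where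
  obj := deltaObj
  map := deltaMap
  map_id F := MapStar.Hom.ext (KarStar.Hom.ext (deltaObj_e F).symm)
  map_comp τ σ := MapStar.Hom.ext (KarStar.Hom.ext (deltaPT_comp τ σ).symm)

end Delta

/-! ### Singletons and the functor `Θ_inf` -/

section Theta

variable {H : Type u} [Order.Frame H]

theorem iSup_punit (f : PUnit.{u + 1} → H) : ⨆ x, f x = f PUnit.unit :=
  le_antisymm (iSup_le fun _ => le_rfl) (le_iSup f PUnit.unit)

/-- The family of relations on a one-point set whose `k`-th relation is `1` iff `k ≤ h`. -/
def pointPT (h : H) : InfPT H PUnit.{u + 1} PUnit.{u + 1} := InfPT.ofMatrix fun _ _ => h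

theorem pointPT_comp (h k : H) : (pointPT h).comp (pointPT k) = pointPT (h ⊓ k) :=
  InfPT.ext_val fun _ _ => by
    simp only [pointPT, InfPT.val_comp, InfPT.val_ofMatrix]
    rw [iSup_punit, inf_comm]

theorem pointPT_inv (h : H) : (pointPT h).inv = pointPT h := rfl

theorem pointPT_mono {h k : H} (hk : h ≤ k) : pointPT h ≤ pointPT k :=
  InfPT.le_iff.2 fun _ _ => by simpa only [pointPT, InfPT.val_ofMatrix] using hk

theorem pointPT_idem (h : H) : (pointPT h).comp (pointPT h) = pointPT h := by
  rw [pointPT_comp, inf_idem]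

/-- The singleton `F_h`: a one-point set, with `F_h(k)(*, *) = 1` iff `k ≤ h`. -/
def singleton (h : H) : RelSheaf H where
  of :=
    { carrier := ⟨PUnit⟩
      e := pointPT h
      symm := pointPT_inv h
      idem := pointPT_idem h }

/-- The singleton morphism `F_h ⟶ F_k` for `h ≤ k`, with `l`-th relation `1` iff `l ≤ h`. -/
def singletonMap {h k : H} (hk : h ≤ k) : singleton h ⟶ singleton k where
  f :=
    { φ := pointPT h
      left := pointPT_idem h
      right := (pointPT_comp h k).trans (by rw [inf_eq_left.2 hk]) }
  total := (pointPT_idem h).ge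
  single := (pointPT_idem h).le.trans (pointPT_mono hk)

variable (H) in
/-- `h ↦ F_h` as a functor. -/
def singletonFunctor : H ⥤ RelSheaf H where
  obj := singleton
  map f := singletonMap (leOfHom f)
  map_id _ := rfl
  map_comp {h k l} f g := MapStar.Hom.ext (KarStar.Hom.ext
    ((pointPT_comp h k).trans (by rw [inf_eq_left.2 (leOfHom f)]; rfl)).symm)

variable (H) in
/-- The functor `Θ_inf : Rel^{H^co}_inf ⥤ Set^{H^op}`: `Θ_inf(F)(h)` is the set of singleton
morphisms `F_h ⟶ F`, restriction is precomposition with `F_k ⟶ F_h`, and `Θ_inf(τ)` is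
postcomposition with `τ`. -/
def ThetaInf : RelSheaf H ⥤ (Hᵒᵖ ⥤ Type u) where
  obj F := (singletonFunctor H).op ⋙ yoneda.obj F
  map τ := Functor.whiskerLeft (singletonFunctor H).op (yoneda.map τ)

/-- The element `α(x) = ⋁ {l | α_l(x, *) = 1}` of a singleton morphism `α`. -/
def sval {F : RelSheaf H} {h : H} (α : singleton h ⟶ F) (x : F.of.carrier.set) : H :=
  InfPT.val α.f.φ x PUnit.unit

/-- The matrix entries of a relational-sheaf. -/
def eval' (F : RelSheaf H) (x y : F.of.carrier.set) : H := InfPT.val F.of.e x y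

theorem sval_ext {F : RelSheaf H} {h : H} {α β : singleton h ⟶ F}
    (e : ∀ x, sval α x = sval β x) : α = β :=
  MapStar.Hom.ext (KarStar.Hom.ext (InfPT.ext_val fun x _ => e x))

theorem sval_right {F : RelSheaf H} {h : H} (α : singleton h ⟶ F) (x : F.of.carrier.set) :
    ⨆ y, eval' F x y ⊓ sval α y = sval α x :=
  (InfPT.val_comp α.f.φ F.of.e x PUnit.unit).symm.trans
    (congrArg (fun τ => InfPT.val τ x PUnit.unit) α.f.right)

theorem sval_le {F : RelSheaf H} {h : H} (α : singleton h ⟶ F) (x : F.of.carrier.set) :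
    sval α x ≤ h := by
  have h1 : ⨆ y : PUnit.{u + 1}, InfPT.val α.f.φ x y ⊓ (pointPT h).val y PUnit.unit = sval α x :=
    (InfPT.val_comp (pointPT h) α.f.φ x PUnit.unit).symm.trans
      (congrArg (fun τ => InfPT.val τ x PUnit.unit) α.f.left)
  rw [← h1]
  refine iSup_le fun _ => inf_le_right.trans ?_
  exact (InfPT.val_ofMatrix (fun _ _ => h) _ _).le

theorem sval_total {F : RelSheaf H} {h : H} (α : singleton h ⟶ F) : h ≤ ⨆ x, sval α x := by
  have h1 := InfPT.le_iff.1 (show pointPT h ≤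
    InfPT.comp (A := PUnit) (D := PUnit) α.f.φ (InfPT.inv α.f.φ) from α.total)
    PUnit.unit PUnit.unit
  have h2 := h1.trans (InfPT.val_comp (A := PUnit) (D := PUnit) α.f.φ (InfPT.inv α.f.φ)
    PUnit.unit PUnit.unit).le
  rw [pointPT, InfPT.val_ofMatrix] at h2
  exact h2.trans (iSup_mono fun x => inf_le_right)

theorem sval_single {F : RelSheaf H} {h : H} (α : singleton h ⟶ F) (x y : F.of.carrier.set) :
    sval α x ⊓ sval α y ≤ eval' F x y := by
  have h1 := InfPT.le_iff.1 (show InfPT.comp (InfPT.inv α.f.φ) α.f.φ ≤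
    F.of.e from α.single) x y
  rw [InfPT.val_comp] at h1
  exact (le_iSup (fun b : PUnit.{u + 1} => InfPT.val α.f.φ x b ⊓ InfPT.val α.f.φ y b)
    PUnit.unit).trans h1

theorem sval_res {F : RelSheaf H} {h k : H} (hk : k ≤ h) (α : singleton h ⟶ F)
    (x : F.of.carrier.set) : sval (singletonMap hk ≫ α) x = sval α x ⊓ k := by
  refine (InfPT.val_comp (pointPT k) α.f.φ x PUnit.unit).trans ?_
  refine (iSup_punit _).trans ?_
  rw [pointPT, InfPT.val_ofMatrix]
  rfl

/-- The family of relations from a one-point set to `X` given by `a : X → H`. -/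
def colPT {X : Type u} (a : X → H) : InfPT H PUnit.{u + 1} X := InfPT.ofMatrix fun x _ => a x

theorem colPT_left {X : Type u} (a : X → H) (h : H) (h2 : ∀ x, a x ≤ h) :
    (pointPT h).comp (colPT a) = colPT a :=
  InfPT.ext_val fun x _ => by
    simp only [pointPT, colPT, InfPT.val_comp, InfPT.val_ofMatrix]
    rw [iSup_punit, inf_eq_left.2 (h2 x)]

theorem colPT_right {X : Type u} (a : X → H) (e : InfPT H X X)
    (h1 : ∀ x, ⨆ y, e.val x y ⊓ a y = a x) : (colPT a).comp e = colPT a :=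
  InfPT.ext_val fun x _ => by
    simp only [colPT, InfPT.val_comp, InfPT.val_ofMatrix, h1]

theorem colPT_total {X : Type u} (a : X → H) (h : H) (h3 : h ≤ ⨆ x, a x) :
    pointPT h ≤ (colPT a).comp (colPT a).inv :=
  InfPT.le_iff.2 fun _ _ => by
    simpa only [pointPT, colPT, InfPT.val_comp, InfPT.val_inv, InfPT.val_ofMatrix, inf_idem]
      using h3

theorem colPT_single {X : Type u} (a : X → H) (e : InfPT H X X)
    (h4 : ∀ x y, a x ⊓ a y ≤ e.val x y) : (colPT a).inv.comp (colPT a) ≤ e :=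
  InfPT.le_iff.2 fun x y => by
    simp only [colPT, InfPT.val_comp, InfPT.val_inv, InfPT.val_ofMatrix]
    exact iSup_le fun _ => h4 x y

/-- A singleton morphism from its values. -/
def mkSingleton (F : RelSheaf H) (h : H) (a : F.of.carrier.set → H)
    (h1 : ∀ x, ⨆ y, eval' F x y ⊓ a y = a x) (h2 : ∀ x, a x ≤ h) (h3 : h ≤ ⨆ x, a x)
    (h4 : ∀ x y, a x ⊓ a y ≤ eval' F x y) : singleton h ⟶ F where
  f :=
    { φ := colPT a
      left := colPT_left a h h2
      right := colPT_right a F.of.e h1 }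
  total := colPT_total a h h3
  single := colPT_single a F.of.e h4

theorem sval_mkSingleton (F : RelSheaf H) (h : H) (a : F.of.carrier.set → H) (h1 h2 h3 h4)
    (x : F.of.carrier.set) : sval (mkSingleton F h a h1 h2 h3 h4) x = a x :=
  InfPT.val_ofMatrix (fun x _ => a x) x PUnit.unit

theorem thetaInf_isShf (F : RelSheaf H) : IsShf ((ThetaInf H).obj F) := by
  intro A X
  let α : ∀ k : A, singleton k.1 ⟶ F := fun k => X.1 k
  have hα : ∀ (k l : A) (x : F.of.carrier.set),
      sval (α k) x ⊓ (k.1 ⊓ l.1) = sval (α l) x ⊓ (k.1 ⊓ l.1) := by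
    intro k l x
    have h := X.2 k l
    have h' : singletonMap (inf_le_left : k.1 ⊓ l.1 ≤ k.1) ≫ α k =
      singletonMap (inf_le_right : k.1 ⊓ l.1 ≤ l.1) ≫ α l := h
    rw [← sval_res inf_le_left, ← sval_res inf_le_right, h']
  have hα' : ∀ (k l : A) (x : F.of.carrier.set), sval (α l) x ⊓ k.1 ≤ sval (α k) x := by
    intro k l x
    refine le_trans (le_inf inf_le_left (le_inf inf_le_right
      (inf_le_left.trans (sval_le (α l) x)))) ?_
    rw [← hα k l x]
    exact inf_le_left
  let a : F.of.carrier.set → H := fun x => ⨆ k : A, sval (α k) x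
  have h1 : ∀ x, ⨆ y, eval' F x y ⊓ a y = a x := by
    intro x
    simp only [a, inf_iSup_eq]
    rw [iSup_comm]
    exact iSup_congr fun k => sval_right (α k) x
  have h2 : ∀ x, a x ≤ sSup A := fun x =>
    iSup_le fun k => (sval_le (α k) x).trans (le_sSup k.2)
  have h3 : sSup A ≤ ⨆ x, a x := sSup_le fun k hk =>
    (sval_total (α ⟨k, hk⟩)).trans (iSup_mono fun x => le_iSup (fun k => sval (α k) x) ⟨k, hk⟩)
  have h4 : ∀ x y, a x ⊓ a y ≤ eval' F x y := by
    intro x y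
    simp only [a, inf_iSup_eq, iSup_inf_eq]
    refine iSup_le fun l => iSup_le fun k => ?_
    refine le_trans (le_inf ?_ inf_le_right) (sval_single (α l) x y)
    exact (inf_le_inf le_rfl (sval_le (α l) y)).trans (hα' l k x)
  refine ⟨mkSingleton F (sSup A) a h1 h2 h3 h4, fun k => ?_, fun β hβ => ?_⟩
  · show singletonMap (le_sSup k.2) ≫ mkSingleton F (sSup A) a h1 h2 h3 h4 = α k
    refine sval_ext fun x => ?_
    rw [sval_res, sval_mkSingleton]
    apply le_antisymm
    · simp only [a, iSup_inf_eq]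
      exact iSup_le fun l => hα' k l x
    · exact le_inf (le_iSup (fun k => sval (α k) x) k) (sval_le (α k) x)
  · let β' : singleton (sSup A) ⟶ F := β
    show β' = mkSingleton F (sSup A) a h1 h2 h3 h4
    refine sval_ext fun x => ?_
    rw [sval_mkSingleton]
    have hb : ∀ k : A, sval β' x ⊓ k.1 = sval (α k) x := by
      intro k
      rw [← sval_res (le_sSup k.2)]
      exact congrArg (fun γ => sval (F := F) (h := k.1) γ x) (hβ k)
    have : sval β' x = sval β' x ⊓ sSup A := (inf_eq_left.2 (sval_le β' x)).symm
    rw [this]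
    have h5 : sSup A = ⨆ k : A, k.1 := sSup_eq_iSup' A
    calc sval β' x ⊓ sSup A = sval β' x ⊓ ⨆ k : A, k.1 := congrArg (sval β' x ⊓ ·) h5
      _ = ⨆ k : A, sval β' x ⊓ k.1 := inf_iSup_eq _ _
      _ = a x := iSup_congr hb

end Theta

/-! ### The comparison functors -/

section Functors

variable (H : Type u) [Order.Frame H]

/-- `Δ_Shv : SHV(H) ⥤ Rel^{H^co}_inf`, the restriction of `Δ_inf` to sheaves. -/
def DeltaShv : SHV H ⥤ RelSheaf H := shvIncl H ⋙ DeltaInf H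

/-- `Θ_Shv : Rel^{H^co}_inf ⥤ SHV(H)`, the functor `Θ_inf` with values in sheaves. -/
def ThetaShv : RelSheaf H ⥤ SHV H := ObjectProperty.lift _ (ThetaInf H) thetaInf_isShf

/-- `Δ_Pre = Φ ∘ Δ_Shv ∘ Γ : Set^{H^op} ⥤ Rel^{H^co}_Ord`. -/
def DeltaPre : (Hᵒᵖ ⥤ Type u) ⥤ RelPresheaf H :=
  Gamma H ⋙ DeltaShv (LowerSet H) ⋙ Phi H

/-- `Θ_Pre = Λ ∘ Θ_Shv ∘ Ψ : Rel^{H^co}_Ord ⥤ Set^{H^op}`. -/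
def ThetaPre : RelPresheaf H ⥤ (Hᵒᵖ ⥤ Type u) :=
  Psi H ⋙ ThetaShv (LowerSet H) ⋙ Lambda H

/-- The associated sheaf functor `a_Shv = Θ_Shv ∘ Δ_inf`. -/
def aShv : (Hᵒᵖ ⥤ Type u) ⥤ SHV H := DeltaInf H ⋙ ThetaShv H

/-- The associated relational-sheaf functor `a_Rel = Δ_inf ∘ Θ_Pre`. -/
def aRel : RelPresheaf H ⥤ RelSheaf H := ThetaPre H ⋙ DeltaInf H

end Functors

end RelSh

/-!
A relational-sheaf on `H` is a symmetric idempotent `H`-valued matrix, and a morphism of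
relational-sheaves is a matrix compatible with these idempotents. Maps in an involutive ordered
category are discretely ordered, so that an equation between parallel morphisms reduces to one
inequality between their entries.

An order-preserving pre-transformation on `H` is the same as a matrix with values in `DH`; hence
`Φ` and `Ψ` are mutually inverse already on pre-transformations. `Γ` and `Λ` are mutually
quasi-inverse because a down-closed set is the union of the principal down-closed sets it contains.

The remaining statements follow from an adjunction `Δ_inf ⊣ Θ_inf`. Its unit sends `x ∈ F(h)` to
the column of `x` in the matrix `Δ_inf(F)`. Its counit is the evaluation matrix `(x, α) ↦ α(x)`,
which is unitary: two singleton morphisms `α`, `β` agree exactly below `⋁_x α(x) ∧ β(x)`, and every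
entry `F(x, y)` is attained by the column of `y`. If `F` is a sheaf, a singleton morphism
`α : F_h ⟶ Δ_inf(F)` is the column of exactly one section, obtained by gluing the restrictions of
the `y ∈ ∐_h F(h)` to `α(y)`; hence the unit is invertible at sheaves.
-/

namespace RelSh

/-! ### Maps in involutive ordered categories -/

section Map

open InvOrdCategory

variable {O : Type w} [Category.{v} O] [InvOrdCategory O] {A B : MapStar O}

theorem MapStar.hom_eq_of_le {f g : A ⟶ B} (h : f.f ≤ g.f) : f = g := by
  refine MapStar.Hom.ext (h.antisymm ?_)
  calc g.f = 𝟙 A.of ≫ g.f := (Category.id_comp _).symm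
    _ ≤ (f.f ≫ star f.f) ≫ g.f := comp_mono f.total le_rfl
    _ ≤ (f.f ≫ star g.f) ≫ g.f := comp_mono (comp_mono le_rfl (star_mono h)) le_rfl
    _ = f.f ≫ star g.f ≫ g.f := Category.assoc _ _ _
    _ ≤ f.f ≫ 𝟙 B.of := comp_mono le_rfl g.single
    _ = f.f := Category.comp_id _

/-- The isomorphism of `Map*(O)` given by a unitary arrow of `O`. -/
def MapStar.isoOfUnitary (f : A.of ⟶ B.of) (hA : f ≫ star f = 𝟙 A.of)
    (hB : star f ≫ f = 𝟙 B.of) : A ≅ B where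
  hom := { f := f, total := hA.ge, single := hB.le }
  inv :=
    { f := star f
      total := by rw [InvOrdCategory.star_star, hB]
      single := by rw [InvOrdCategory.star_star, hA] }
  hom_inv_id := MapStar.Hom.ext hA
  inv_hom_id := MapStar.Hom.ext hB

end Map

/-! ### The equivalence of relational-presheaves on `H` and relational-sheaves on `DH` -/

section Semifunctor

variable {C : Type w} [InvOrdSemicategory.{w, v} C] {D : Type w} [InvOrdSemicategory.{w, v} D]
  {E : Type w} [InvOrdSemicategory.{w, v} E]

namespace InvOrdSemifunctor

variable (C) in
/-- The identity semifunctor. -/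
protected def id : InvOrdSemifunctor C C where
  obj A := A
  map f := f
  map_comp _ _ := rfl
  map_star _ := rfl
  map_mono h := h

/-- The composite `T ∘ S` of semifunctors. -/
def comp (S : InvOrdSemifunctor C D) (T : InvOrdSemifunctor D E) : InvOrdSemifunctor C E where
  obj A := T.obj (S.obj A)
  map f := T.map (S.map f)
  map_comp f g := by rw [S.map_comp, T.map_comp]
  map_star f := by rw [S.map_star, T.map_star]
  map_mono h := T.map_mono (S.map_mono h)

theorem eq_id {T : InvOrdSemifunctor C C} (hobj : ∀ A, T.obj A = A)
    (hmap : ∀ {A B : C} (f : InvOrdSemicategory.Hom A B), T.map f ≍ f) :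
    T = InvOrdSemifunctor.id C := by
  obtain ⟨obj, map, _, _, _⟩ := T
  obtain rfl : obj = fun A => A := funext hobj
  obtain rfl : @map = fun _ _ f => f :=
    funext fun A => funext fun B => funext fun f => eq_of_heq (hmap f)
  rfl

theorem mapKar_id : (InvOrdSemifunctor.id C).mapKar = 𝟭 (MapStar (KarStar C)) := rfl

theorem mapKar_comp (S : InvOrdSemifunctor C D) (T : InvOrdSemifunctor D E) :
    (S.comp T).mapKar = S.mapKar ⋙ T.mapKar := rfl

end InvOrdSemifunctor

end Semifunctor

section Comparison

variable (H : Type u) [Order.Frame H]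

theorem psiSemi_comp_phiSemi :
    (psiSemi H).comp (phiSemi H) = InvOrdSemifunctor.id (PTOrd H) :=
  InvOrdSemifunctor.eq_id (fun _ => rfl) fun τ =>
    heq_of_eq (OrdPT.ext_iff' fun h b a =>
      ⟨fun hτ => hτ h le_rfl, fun hτ _ hk => OrdPT.lower τ a b hk hτ⟩)

variable {H} in
theorem InfPT.rel_iff_forall_rel_Iic {A B : Type u} (τ : InfPT (LowerSet H) A B) (X : LowerSet H)
    (b : B) (a : A) : τ.rel X b a ↔ ∀ h ∈ X, τ.rel (LowerSet.Iic h) b a := by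
  simp only [InfPT.rel_iff, LowerSet.Iic_le]
  rfl

theorem phiSemi_comp_psiSemi :
    (phiSemi H).comp (psiSemi H) = InvOrdSemifunctor.id (PTInf (LowerSet H)) :=
  InvOrdSemifunctor.eq_id (fun _ => rfl) fun τ =>
    heq_of_eq (InfPT.ext (funext fun X => funext fun b => funext fun a =>
      propext (InfPT.rel_iff_forall_rel_Iic τ X b a).symm))

theorem Psi_comp_Phi : Psi H ⋙ Phi H = 𝟭 (RelPresheaf H) := by
  rw [Psi, Phi, ← InvOrdSemifunctor.mapKar_comp, psiSemi_comp_phiSemi,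
    InvOrdSemifunctor.mapKar_id]

theorem Phi_comp_Psi : Phi H ⋙ Psi H = 𝟭 (RelSheaf (LowerSet H)) := by
  rw [Psi, Phi, ← InvOrdSemifunctor.mapKar_comp, phiSemi_comp_psiSemi,
    InvOrdSemifunctor.mapKar_id]

/-- The equivalence of relational-sheaves on `DH` and relational-presheaves on `H` formed by `Φ`
and `Ψ`. -/
def phiPsiEquivalence : RelSheaf (LowerSet H) ≌ RelPresheaf H :=
  CategoryTheory.Equivalence.mk (Phi H) (Psi H) (eqToIso (Phi_comp_Psi H).symm)
    (eqToIso (Psi_comp_Phi H))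

end Comparison

/-! ### The equivalence of presheaves on `H` and sheaves on `DH` -/

theorem isIso_of_bijective_app {C : Type w} [Category.{v} C] {F G : C ⥤ Type u} {τ : F ⟶ G}
    (hτ : ∀ X, Function.Bijective (τ.app X)) : IsIso τ :=
  (NatTrans.isIso_iff_isIso_app τ).2 fun X => (isIso_iff_bijective (τ.app X)).2 (hτ X)

section Gluing

variable {H : Type u} [Order.Frame H]

theorem IsShf.existsUnique_gluing {F : Hᵒᵖ ⥤ Type u} (hF : IsShf F) {ι : Type*} {k : ι → H}
    {h : H} (hk : ⨆ i, k i = h) (x : ∀ i, F.obj (op (k i)))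
    (hx : ∀ (i j : ι) (m : H) (hi : m ≤ k i) (hj : m ≤ k j), res F hi (x i) = res F hj (x j)) :
    ∃! y : F.obj (op h), ∀ (i : ι) (hi : k i ≤ h), res F hi y = x i := by
  subst hk
  choose i hi using fun m : Set.range k => m.2
  let X : MatchingFamily F (Set.range k) :=
    ⟨fun m => res F (hi m).ge (x (i m)), fun m n => by simpa only [res_res] using hx _ _ _ _ _⟩
  have hX : ∀ j, X.1 ⟨k j, j, rfl⟩ = x j := fun j =>
    (hx _ j (k j) _ le_rfl).trans (res_self F (x j))
  obtain ⟨y, hy, hunique⟩ := hF (Set.range k) X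
  refine ⟨y, fun j _ => (hy ⟨k j, j, rfl⟩).trans (hX j), fun z hz => hunique z ?_⟩
  rintro ⟨_, j, rfl⟩
  exact (hz j _).trans (hX j).symm

theorem IsShf.eq_of_res_eq {F : Hᵒᵖ ⥤ Type u} (hF : IsShf F) {ι : Type*} {k : ι → H} {h : H}
    (hk : ⨆ i, k i = h) {x y : F.obj (op h)}
    (hxy : ∀ (i : ι) (hi : k i ≤ h), res F hi x = res F hi y) : x = y :=
  (hF.existsUnique_gluing hk (fun i => res F (hk ▸ le_iSup k i) y)
    fun i j m hi hj => by rw [res_res, res_res]).unique hxy (fun _ _ => rfl)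

end Gluing

section GammaLambda

variable {H : Type u} [Order.Frame H]

/-- The matching family on `h†` of the restrictions of `x ∈ F(h)`. -/
def principalFamily (F : Hᵒᵖ ⥤ Type u) {h : H} (x : F.obj (op h)) :
    MatchingFamily F (LowerSet.Iic h : Set H) :=
  ⟨fun k => res F k.2 x, fun _ _ => (res_res F _ _ x).trans (res_res F _ _ x).symm⟩

theorem principalFamily_bijective (F : Hᵒᵖ ⥤ Type u) (h : H) :
    Function.Bijective (principalFamily F (h := h)) := by
  refine ⟨fun x y hxy => ?_, fun X => ⟨X.1 ⟨h, le_rfl⟩, ?_⟩⟩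
  · have htop : res F le_rfl x = res F le_rfl y := congrFun (congrArg Subtype.val hxy) ⟨h, le_rfl⟩
    rwa [res_self, res_self] at htop
  · exact Subtype.ext (funext fun k => X.res_eq k.2 _ k.2)

variable (H) in
/-- The natural transformation `F(h) → ΛΓ(F)(h)`. -/
def toLambdaGamma : 𝟭 (Hᵒᵖ ⥤ Type u) ⟶ Gamma H ⋙ Lambda H where
  app F :=
    { app := fun h => ↾fun x => principalFamily F (h := h.unop) x
      naturality := fun _ _ f => by
        ext x
        exact Subtype.ext (funext fun k => res_res F (leOfHom f.unop) k.2 x) }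
  naturality _ _ τ := by
    ext h x
    exact Subtype.ext (funext fun k => (app_res τ k.2 x).symm)

instance : IsIso (toLambdaGamma H) :=
  (NatTrans.isIso_iff_isIso_app _).2 fun F =>
    isIso_of_bijective_app fun h => principalFamily_bijective F h.unop

/-- The matching family on `A` of the restrictions of `x ∈ F(A)` to the principal down-closed
subsets of `A`. -/
def sectionFamily (F : SHV (LowerSet H)) {A : LowerSet H} (x : F.obj.obj (op A)) :
    MatchingFamily ((Lambda H).obj F) (A : Set H) :=
  ⟨fun k => res F.obj (LowerSet.Iic_le.2 k.2) x,
    fun _ _ => (res_res F.obj _ _ x).trans (res_res F.obj _ _ x).symm⟩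

theorem iSup_Iic_mem (A : LowerSet H) : ⨆ k : A, LowerSet.Iic k.1 = A :=
  SetLike.ext fun h => by
    simp only [LowerSet.mem_iSup_iff, LowerSet.mem_Iic_iff, Subtype.exists, exists_prop]
    exact ⟨fun ⟨_, hk, hhk⟩ => A.lower hhk hk, fun hh => ⟨h, hh, le_rfl⟩⟩

theorem sectionFamily_bijective (F : SHV (LowerSet H)) (A : LowerSet H) :
    Function.Bijective (sectionFamily F (A := A)) := by
  refine ⟨fun x y hxy => F.property.eq_of_res_eq (iSup_Iic_mem A) fun k _ =>
    congrFun (congrArg Subtype.val hxy) k, fun X => ?_⟩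
  have hX : ∀ (k l : A) (B : LowerSet H) (hk : B ≤ LowerSet.Iic k.1) (hl : B ≤ LowerSet.Iic l.1),
      res F.obj hk (X.1 k) = res F.obj hl (X.1 l) := fun k l B hk hl => by
    have hB : B ≤ LowerSet.Iic (k.1 ⊓ l.1) := fun m hm => le_inf (hk hm) (hl hm)
    exact (res_res F.obj _ hB _).symm.trans
      ((congrArg (res F.obj hB) (X.2 k l)).trans (res_res F.obj _ hB _))
  obtain ⟨x, hx, -⟩ := F.property.existsUnique_gluing (iSup_Iic_mem A) X.1 hX
  exact ⟨x, Subtype.ext (funext fun k => hx k _)⟩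

variable (H) in
/-- The natural transformation `F(A) → ΓΛ(F)(A)`. -/
def toGammaLambda : 𝟭 (SHV (LowerSet H)) ⟶ Lambda H ⋙ Gamma H where
  app F := ObjectProperty.homMk
    { app := fun A => ↾fun x => sectionFamily F (A := A.unop) x
      naturality := fun _ _ f => by
        ext x
        exact Subtype.ext (funext fun k =>
          res_res F.obj (leOfHom f.unop) (LowerSet.Iic_le.2 k.2) x) }
  naturality _ _ τ := by
    ext A x
    exact Subtype.ext (funext fun k => (app_res τ.hom (LowerSet.Iic_le.2 k.2) x).symm)

instance : IsIso (toGammaLambda H) :=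
  (NatTrans.isIso_iff_isIso_app _).2 fun F => (ObjectProperty.isIso_hom_iff _).1 <|
    isIso_of_bijective_app fun A => sectionFamily_bijective F A.unop

variable (H) in
/-- The equivalence of presheaves on `H` and sheaves on `DH` formed by `Γ` and `Λ`. -/
noncomputable def gammaLambdaEquivalence : (Hᵒᵖ ⥤ Type u) ≌ SHV (LowerSet H) :=
  CategoryTheory.Equivalence.mk (Gamma H) (Lambda H) (asIso (toLambdaGamma H))
    (asIso (toGammaLambda H)).symm

end GammaLambda

/-! ### Morphisms of relational-sheaves as matrices -/

section Matrix

variable {H : Type u} [Order.Frame H] {F G K : RelSheaf H} {h : H}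

theorem InfPT.comp_assoc {A B C D : Type u} (τ : InfPT H A B) (σ : InfPT H B C)
    (ρ : InfPT H C D) : (τ.comp σ).comp ρ = τ.comp (σ.comp ρ) :=
  InvOrdSemicategory.assoc (C := PTInf H) (A := ⟨A⟩) (B := ⟨B⟩) (D := ⟨C⟩) (E := ⟨D⟩) τ σ ρ

/-- The matrix entries of a morphism of relational-sheaves. -/
def entry (f : F ⟶ G) (y : G.of.carrier.set) (x : F.of.carrier.set) : H := InfPT.val f.f.φ y x

theorem entry_comp (f : F ⟶ G) (g : G ⟶ K) (z : K.of.carrier.set) (x : F.of.carrier.set) :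
    entry (f ≫ g) z x = ⨆ y, entry g z y ⊓ entry f y x :=
  InfPT.val_comp f.f.φ g.f.φ z x

theorem iSup_entry_inf_eval' (f : F ⟶ G) (y : G.of.carrier.set) (x : F.of.carrier.set) :
    ⨆ z, entry f y z ⊓ eval' F z x = entry f y x :=
  (entry_comp (𝟙 F) f y x).symm.trans (by rw [Category.id_comp])

theorem hom_eq_of_entry_le {f g : F ⟶ G} (hfg : ∀ y x, entry f y x ≤ entry g y x) : f = g :=
  MapStar.hom_eq_of_le (InfPT.le_iff.2 hfg)

theorem eval'_symm (F : RelSheaf H) (x y : F.of.carrier.set) : eval' F x y = eval' F y x :=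
  congrArg (fun τ => InfPT.val τ y x) F.of.symm

theorem eval'_trans (F : RelSheaf H) (x y z : F.of.carrier.set) :
    eval' F x y ⊓ eval' F y z ≤ eval' F x z :=
  (le_iSup (fun y => eval' F x y ⊓ eval' F y z) y).trans (iSup_entry_inf_eval' (𝟙 F) x z).le

theorem eval'_le_right (F : RelSheaf H) (x y : F.of.carrier.set) : eval' F x y ≤ eval' F y y :=
  (le_inf (eval'_symm F x y).le le_rfl).trans (eval'_trans F y x y)

theorem hom_eq_of_sval_le {α β : singleton h ⟶ F} (hαβ : ∀ x, sval α x ≤ sval β x) : α = β :=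
  hom_eq_of_entry_le fun x _ => hαβ x

theorem sval_comp (α : singleton h ⟶ F) (f : F ⟶ G) (y : G.of.carrier.set) :
    sval (α ≫ f) y = ⨆ x, entry f y x ⊓ sval α x :=
  entry_comp α f y PUnit.unit

theorem eval'_inf_sval_le (α : singleton h ⟶ F) (x y : F.of.carrier.set) :
    eval' F x y ⊓ sval α y ≤ sval α x :=
  (le_iSup (fun y => eval' F x y ⊓ sval α y) y).trans (sval_right α x).le

/-- The column of `x` in the matrix of `F`, as a singleton morphism. -/
def eltSingleton (F : RelSheaf H) (x : F.of.carrier.set) (hx : eval' F x x = h) :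
    singleton h ⟶ F :=
  mkSingleton F h (fun y => eval' F y x)
    (fun y => iSup_entry_inf_eval' (𝟙 F) y x)
    (fun y => (eval'_le_right F y x).trans hx.le)
    (hx.ge.trans (le_iSup (fun y => eval' F y x) x))
    (fun y z => (inf_le_inf_left _ (eval'_symm F z x).le).trans (eval'_trans F y x z))

theorem sval_eltSingleton (F : RelSheaf H) (x : F.of.carrier.set) (hx : eval' F x x = h)
    (y : F.of.carrier.set) : sval (eltSingleton F x hx) y = eval' F y x :=
  sval_mkSingleton ..

theorem sval_eltSingleton_comp (x : F.of.carrier.set) (hx : eval' F x x = h) (f : F ⟶ G)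
    (y : G.of.carrier.set) : sval (eltSingleton F x hx ≫ f) y = entry f y x := by
  simp only [sval_comp, sval_eltSingleton, iSup_entry_inf_eval']

end Matrix

/-! ### The adjunction `Δ_inf ⊣ Θ_inf` -/

section Unit

variable {H : Type u} [Order.Frame H]

theorem eval'_deltaObj (F : Hᵒᵖ ⥤ Type u) (b a : Elts F) :
    eval' (deltaObj F) b a = agree F b a :=
  InfPT.val_ofMatrix _ b a

theorem entry_deltaMap {F G : Hᵒᵖ ⥤ Type u} (τ : F ⟶ G) (b : Elts G) (a : Elts F) :
    entry (deltaMap τ) b a = agree G b (eltsMap τ a) :=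
  InfPT.val_ofMatrix _ b a

theorem le_agree_res (F : Hᵒᵖ ⥤ Type u) {h k : H} (hk : k ≤ h) (x : F.obj (op h)) :
    k ≤ agree F ⟨k, res F hk x⟩ ⟨h, x⟩ :=
  le_sSup ⟨le_rfl, hk, res_self F _⟩

/-- The singleton morphism of a section `x ∈ F(h)`, the unit of `Δ_inf ⊣ Θ_inf` at `x`. -/
def sectionSingleton (F : Hᵒᵖ ⥤ Type u) {h : H} (x : F.obj (op h)) : singleton h ⟶ deltaObj F :=
  eltSingleton (deltaObj F) ⟨h, x⟩ ((eval'_deltaObj F _ _).trans (agree_self F _))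

theorem sval_sectionSingleton (F : Hᵒᵖ ⥤ Type u) {h : H} (x : F.obj (op h)) (y : Elts F) :
    sval (sectionSingleton F x) y = agree F y ⟨h, x⟩ :=
  (sval_eltSingleton ..).trans (eval'_deltaObj F y _)

theorem sectionSingleton_res (F : Hᵒᵖ ⥤ Type u) {h k : H} (hk : k ≤ h) (x : F.obj (op h)) :
    sectionSingleton F (res F hk x) = singletonMap hk ≫ sectionSingleton F x :=
  hom_eq_of_sval_le fun y => by
    have hyk : sval (sectionSingleton F (res F hk x)) y ≤ k := sval_le _ y
    rw [sval_res]
    refine le_inf ?_ hyk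
    calc sval (sectionSingleton F (res F hk x)) y
      _ ≤ agree F y ⟨k, res F hk x⟩ ⊓ agree F ⟨k, res F hk x⟩ ⟨h, x⟩ :=
        le_inf (sval_sectionSingleton F _ y).le (hyk.trans (le_agree_res F hk x))
      _ ≤ agree F y ⟨h, x⟩ := agree_trans F y _ _
      _ = sval (sectionSingleton F x) y := (sval_sectionSingleton F x y).symm

theorem sval_sectionSingleton_comp (F : Hᵒᵖ ⥤ Type u) {G : RelSheaf H} {h : H}
    (x : F.obj (op h)) (f : deltaObj F ⟶ G) (y : G.of.carrier.set) :
    sval (sectionSingleton F x ≫ f) y = entry f y ⟨h, x⟩ :=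
  sval_eltSingleton_comp _ _ f y

theorem sectionSingleton_comp_deltaMap {F G : Hᵒᵖ ⥤ Type u} (τ : F ⟶ G) {h : H}
    (x : F.obj (op h)) :
    sectionSingleton F x ≫ deltaMap τ = sectionSingleton G (τ.app (op h) x) :=
  sval_ext fun y => (sval_sectionSingleton_comp F x _ y).trans
    ((entry_deltaMap τ y ⟨h, x⟩).trans (sval_sectionSingleton G _ y).symm)

variable (H) in
/-- The unit `F(h) → Θ_inf Δ_inf(F)(h)`. -/
def deltaThetaUnit : 𝟭 (Hᵒᵖ ⥤ Type u) ⟶ DeltaInf H ⋙ ThetaInf H where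
  app F :=
    { app := fun h => ↾fun x => sectionSingleton F (h := h.unop) x
      naturality := fun _ _ f => by
        ext x
        exact sectionSingleton_res F (leOfHom f.unop) x }
  naturality _ _ τ := by
    ext h x
    exact (sectionSingleton_comp_deltaMap τ x).symm

end Unit

section Counit

variable {H : Type u} [Order.Frame H] {F : RelSheaf H}

/-- An element of `∐_h Θ_inf(F)(h)` as a singleton morphism. -/
def toSingleton (α : Elts ((ThetaInf H).obj F)) : singleton α.1 ⟶ F := α.2

theorem sval_toSingleton_inf_agree_le (β α : Elts ((ThetaInf H).obj F))
    (x : F.of.carrier.set) :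
    sval (toSingleton β) x ⊓ agree _ β α ≤ sval (toSingleton α) x := by
  unfold agree
  rw [inf_sSup_eq]
  refine iSup₂_le fun m ⟨hβ, hα, hres⟩ => ?_
  have hres' : singletonMap hβ ≫ toSingleton β = singletonMap hα ≫ toSingleton α := hres
  rw [← sval_res hβ, hres', sval_res hα]
  exact inf_le_left

theorem agree_thetaInf (α β : Elts ((ThetaInf H).obj F)) :
    agree _ α β = ⨆ x, sval (toSingleton α) x ⊓ sval (toSingleton β) x := by
  apply le_antisymm
  · have htotal : agree _ α β ≤ ⨆ x, sval (toSingleton α) x :=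
      (agree_symm _ α β).le.trans ((agree_le_right _ β α).trans (sval_total (toSingleton α)))
    calc agree _ α β = (⨆ x, sval (toSingleton α) x) ⊓ agree _ α β := (inf_eq_right.2 htotal).symm
      _ = ⨆ x, sval (toSingleton α) x ⊓ agree _ α β := iSup_inf_eq _ _
      _ ≤ ⨆ x, sval (toSingleton α) x ⊓ sval (toSingleton β) x :=
        iSup_mono fun x => le_inf inf_le_left (sval_toSingleton_inf_agree_le α β x)
  · have hα : ⨆ x, sval (toSingleton α) x ⊓ sval (toSingleton β) x ≤ α.1 :=
      iSup_le fun x => inf_le_left.trans (sval_le _ x)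
    have hβ : ⨆ x, sval (toSingleton α) x ⊓ sval (toSingleton β) x ≤ β.1 :=
      iSup_le fun x => inf_le_right.trans (sval_le _ x)
    refine le_sSup ⟨hα, hβ, ?_⟩
    change singletonMap hα ≫ toSingleton α = singletonMap hβ ≫ toSingleton β
    refine hom_eq_of_sval_le fun y => ?_
    simp only [sval_res]
    refine le_inf ?_ inf_le_right
    rw [inf_iSup_eq]
    refine iSup_le fun x => ?_
    rw [← inf_assoc]
    exact (inf_le_inf_right _ (sval_single _ y x)).trans (eval'_inf_sval_le _ y x)

theorem iSup_sval_inf_sval (F : RelSheaf H) (x y : F.of.carrier.set) :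
    ⨆ α : Elts ((ThetaInf H).obj F), sval (toSingleton α) x ⊓ sval (toSingleton α) y =
      eval' F x y := by
  refine le_antisymm (iSup_le fun α => sval_single (toSingleton α) x y) ?_
  refine le_trans (le_inf ?_ ?_) (le_iSup (fun α : Elts ((ThetaInf H).obj F) =>
    sval (toSingleton α) x ⊓ sval (toSingleton α) y) ⟨eval' F y y, eltSingleton F y rfl⟩)
  · exact (sval_eltSingleton F y rfl x).ge
  · exact (eval'_le_right F x y).trans (sval_eltSingleton F y rfl y).ge

/-- The evaluation matrix `(x, α) ↦ α(x)`, the counit of `Δ_inf ⊣ Θ_inf`. -/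
def evalPT (F : RelSheaf H) : InfPT H (Elts ((ThetaInf H).obj F)) F.of.carrier.set :=
  InfPT.ofMatrix fun x α => sval (toSingleton α) x

theorem evalPT_comp_inv (F : RelSheaf H) :
    (evalPT F).comp (evalPT F).inv = (deltaObj ((ThetaInf H).obj F)).of.e :=
  InfPT.ext_val fun α β => by
    rw [InfPT.val_comp]
    simp only [InfPT.val_inv, evalPT, InfPT.val_ofMatrix, ← agree_thetaInf]
    exact (eval'_deltaObj _ α β).symm

theorem evalPT_inv_comp (F : RelSheaf H) : (evalPT F).inv.comp (evalPT F) = F.of.e :=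
  InfPT.ext_val fun x y => by
    rw [InfPT.val_comp]
    simp only [InfPT.val_inv, evalPT, InfPT.val_ofMatrix, iSup_sval_inf_sval]
    rfl

theorem evalPT_right (F : RelSheaf H) : (evalPT F).comp F.of.e = evalPT F :=
  InfPT.ext_val fun x α => by
    rw [InfPT.val_comp]
    simp only [evalPT, InfPT.val_ofMatrix]
    exact sval_right (toSingleton α) x

theorem evalPT_left (F : RelSheaf H) :
    InfPT.comp (A := Elts _) (B := Elts _) (deltaObj ((ThetaInf H).obj F)).of.e (evalPT F) =
      evalPT F := by
  rw [← evalPT_comp_inv, InfPT.comp_assoc, evalPT_inv_comp, evalPT_right]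

/-- Evaluation of singleton morphisms as an isomorphism `Δ_inf Θ_inf(F) ≅ F`. -/
def evalIso (F : RelSheaf H) : deltaObj ((ThetaInf H).obj F) ≅ F :=
  MapStar.isoOfUnitary ⟨evalPT F, evalPT_left F, evalPT_right F⟩
    (KarStar.Hom.ext (evalPT_comp_inv F)) (KarStar.Hom.ext (evalPT_inv_comp F))

theorem entry_evalIso_hom (x : F.of.carrier.set) (α : Elts ((ThetaInf H).obj F)) :
    entry (evalIso F).hom x α = sval (toSingleton α) x :=
  InfPT.val_ofMatrix _ x α

theorem entry_deltaMap_comp_evalIso {P : Hᵒᵖ ⥤ Type u} (τ : P ⟶ (ThetaInf H).obj F)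
    (x : F.of.carrier.set) (a : Elts P) :
    entry (deltaMap τ ≫ (evalIso F).hom) x a = sval (toSingleton (eltsMap τ a)) x := by
  refine (entry_comp (deltaMap τ) (evalIso F).hom x a).trans ?_
  refine (iSup_congr fun β => congrArg₂ _ (entry_evalIso_hom x β) (entry_deltaMap τ β a)).trans ?_
  refine le_antisymm (iSup_le fun β => sval_toSingleton_inf_agree_le β _ x) ?_
  refine le_trans (le_inf le_rfl ?_)
    (le_iSup (fun β => sval (toSingleton β) x ⊓ agree _ β (eltsMap τ a)) (eltsMap τ a))
  exact (sval_le _ x).trans (agree_self _ _).ge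

variable (H) in
/-- The counit `Δ_inf Θ_inf(F) ≅ F`. -/
def deltaThetaCounit : ThetaInf H ⋙ DeltaInf H ≅ 𝟭 (RelSheaf H) :=
  NatIso.ofComponents evalIso fun {F G} f => hom_eq_of_entry_le fun y α => by
    refine (entry_deltaMap_comp_evalIso ((ThetaInf H).map f) y α).le.trans ?_
    refine (sval_comp (toSingleton α) f y).le.trans ?_
    refine le_of_le_of_eq (iSup_mono fun x => ?_) (entry_comp (evalIso F).hom f y α).symm
    exact inf_le_inf_left _ (entry_evalIso_hom x α).ge

variable (H) in
/-- The adjunction `Δ_inf ⊣ Θ_inf`. -/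
def deltaThetaAdjunction : DeltaInf H ⊣ ThetaInf H where
  unit := deltaThetaUnit H
  counit := (deltaThetaCounit H).hom
  left_triangle_components F := hom_eq_of_entry_le fun y a =>
    (entry_deltaMap_comp_evalIso ((deltaThetaUnit H).app F) y a).le.trans
      ((sval_sectionSingleton F a.2 y).trans (eval'_deltaObj F y a).symm).le
  right_triangle_components F := by
    ext h α
    exact sval_ext fun x =>
      (sval_sectionSingleton_comp _ α (evalIso F).hom x).trans (entry_evalIso_hom x ⟨h.unop, α⟩)

end Counit

/-! ### Sheaves and relational-sheaves -/

section Sheaf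

variable {H : Type u} [Order.Frame H] {F : Hᵒᵖ ⥤ Type u}

theorem IsShf.res_eq_of_le_agree (hF : IsShf F) {m : H} {b a : Elts F} (hb : m ≤ b.1)
    (ha : m ≤ a.1) (hm : m ≤ agree F b a) : res F hb b.2 = res F ha a.2 := by
  have hcover : ⨆ n : {n | ∃ (hb : n ≤ b.1) (ha : n ≤ a.1), res F hb b.2 = res F ha a.2},
      n.1 ⊓ m = m := by
    rw [← iSup_inf_eq, ← sSup_eq_iSup']
    exact inf_eq_right.2 hm
  refine hF.eq_of_res_eq hcover fun ⟨n, hnb, hna, hn⟩ hnm => ?_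
  simpa only [res_res] using congrArg (res F (inf_le_left : n ⊓ m ≤ n)) hn

theorem sectionSingleton_injective (hF : IsShf F) (h : H) :
    Function.Injective (sectionSingleton F (h := h)) := fun x y hxy => by
  have hagree : agree F ⟨h, x⟩ ⟨h, y⟩ = h := by
    rw [← sval_sectionSingleton, ← hxy, sval_sectionSingleton, agree_self]
  simpa only [res_self] using hF.res_eq_of_le_agree (b := ⟨h, x⟩) (a := ⟨h, y⟩)
    le_rfl le_rfl hagree.ge

theorem sectionSingleton_surjective (hF : IsShf F) (h : H) :
    Function.Surjective (sectionSingleton F (h := h)) := fun α => by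
  have hsingle : ∀ y z : Elts F, sval α y ⊓ sval α z ≤ agree F y z := fun y z =>
    (sval_single α y z).trans (eval'_deltaObj F y z).le
  have hle : ∀ y : Elts F, sval α y ≤ y.1 := fun y =>
    (le_inf le_rfl le_rfl).trans ((hsingle y y).trans (agree_le_right F y y))
  have hcover : ⨆ y : Elts F, sval α y = h :=
    (iSup_le fun y => sval_le α y).antisymm (sval_total α)
  obtain ⟨x, hx, -⟩ := hF.existsUnique_gluing hcover (fun y => res F (hle y) y.2)
    fun y z m hy hz => by
      rw [res_res, res_res]
      exact hF.res_eq_of_le_agree _ _ ((le_inf hy hz).trans (hsingle y z))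
  refine ⟨x, (hom_eq_of_sval_le fun y : Elts F => ?_).symm⟩
  rw [sval_sectionSingleton]
  exact le_sSup ⟨hle y, sval_le α y, (hx y _).symm⟩

theorem isIso_deltaThetaUnit_app (hF : IsShf F) : IsIso ((deltaThetaUnit H).app F) :=
  isIso_of_bijective_app fun h =>
    ⟨sectionSingleton_injective hF h.unop, sectionSingleton_surjective hF h.unop⟩

variable (H) in
/-- The isomorphism of the inclusion of sheaves and `Θ_inf ∘ Δ_Shv` given by the unit of
`Δ_inf ⊣ Θ_inf`. -/
noncomputable def shvInclIso : shvIncl H ≅ DeltaShv H ⋙ ThetaInf H :=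
  NatIso.ofComponents
    (fun F => @asIso _ _ _ _ ((deltaThetaUnit H).app F.obj) (isIso_deltaThetaUnit_app F.property))
    fun τ => (deltaThetaUnit H).naturality τ.hom

variable (H) in
/-- The equivalence of sheaves and relational-sheaves formed by `Δ_Shv` and `Θ_Shv`. -/
noncomputable def deltaShvEquivalence : SHV H ≌ RelSheaf H :=
  CategoryTheory.Equivalence.mk (DeltaShv H) (ThetaShv H)
    (((ObjectProperty.fullyFaithfulι _).whiskeringRight _).preimageIso (shvInclIso H))
    (deltaThetaCounit H)

end Sheaf

end RelSh

theorem mainTheorem2 (H : Type u) [Order.Frame H] :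
    (∃ e : (Hᵒᵖ ⥤ Type u) ≌ RelSh.RelPresheaf H,
      e.functor = RelSh.DeltaPre H ∧ e.inverse = RelSh.ThetaPre H) ∧
    (∃ e : (Hᵒᵖ ⥤ Type u) ≌ RelSh.SHV (LowerSet H),
      e.functor = RelSh.Gamma H ∧ e.inverse = RelSh.Lambda H) ∧
    (∃ e : RelSh.SHV (LowerSet H) ≌ RelSh.RelSheaf (LowerSet H),
      e.functor = RelSh.DeltaShv (LowerSet H) ∧ e.inverse = RelSh.ThetaShv (LowerSet H)) ∧
    (∃ e : RelSh.RelSheaf (LowerSet H) ≌ RelSh.RelPresheaf H,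
      e.functor = RelSh.Phi H ∧ e.inverse = RelSh.Psi H) ∧
    Nonempty (RelSh.aShv H ⊣ RelSh.DeltaShv H ⋙ RelSh.ThetaInf H) ∧
    Nonempty (RelSh.DeltaShv H ⋙ RelSh.ThetaInf H ≅ RelSh.shvIncl H) ∧
    Nonempty (RelSh.aRel H ⊣ RelSh.ThetaInf H ⋙ RelSh.DeltaPre H) := by
  let ePre := (RelSh.gammaLambdaEquivalence H).trans
    ((RelSh.deltaShvEquivalence (LowerSet H)).trans (RelSh.phiPsiEquivalence H))
  exact ⟨⟨ePre, rfl, rfl⟩,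
    ⟨RelSh.gammaLambdaEquivalence H, rfl, rfl⟩,
    ⟨RelSh.deltaShvEquivalence (LowerSet H), rfl, rfl⟩,
    ⟨RelSh.phiPsiEquivalence H, rfl, rfl⟩,
    ⟨(RelSh.deltaThetaAdjunction H).comp (RelSh.deltaShvEquivalence H).symm.toAdjunction⟩,
    ⟨(RelSh.shvInclIso H).symm⟩,
    ⟨ePre.symm.toAdjunction.comp (RelSh.deltaThetaAdjunction H)⟩⟩
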